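/- A ternary $\mathbb{Z}$-lattice is a $\mathbb{Z}$-lattice $L$ of rank $3$ on a $3$-dimensional positive definite quadratic space $(V,Q)$ over $\mathbb{Q}$, with $B(x,y)=\tfrac12\bigl(Q(x+y)-Q(x)-Q(y)\bigr)$; it is always assumed to be non-classic integral, that is, the ideal generated by the values $Q(x)$, $x\in L$, equals $\mathbb{Z}$. Let $dL=\det(B(x_i,x_j))$ for a $\mathbb{Z}$-basis $x_1,x_2,x_3$ of $L$ (so $4\,dL\in\mathbb{Z}$), let $r(n,L)=|\{x\in L: Q(x)=n\}|$ for $n\in\mathbb{Z}$, and let $$m_s(L)=\min\{n\in\mathbb{Z}_{>0}: r(n^2,L)\neq 0\}$$ when $L$ represents the square of some positive integer. Two lattices are isometric if an isometry of the ambient quadratic spaces maps one onto the other. Call $L$ strongly $s$-regular if for all positive integers $n_1,n_2$ such that every prime factor of $n_1$ divides $8\,dL$ and $\gcd(n_2,8\,dL)=1$, with $n=n_1n_2$ one has $$r(n_1^2n_2^2,L)=r(n_1^2,L)\prod_{p\nmid 8dL}\left(\frac{p^{\lambda_p+1}-1}{p-1}-\left(\frac{-dL}{p}\right)\frac{p^{\lambda_p}-1}{p-1}\right),\qquad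 \lambda_p=\mathrm{ord}_p(n),$$ where $p$ runs over primes and the Legendre symbol $\left(\frac{-dL}{p}\right)$ means $\left(\frac{-4\,dL}{p}\right)$ (this is the same when $dL$ is an integer). Theorem. For every positive integer $m$ there are, up to isometry, only finitely many strongly $s$-regular ternary $\mathbb{Z}$-lattices $L$ with $m_s(L)=m$. -/

import Mathlib

universe u

/-- A ternary `ℤ`-lattice: a full `ℤ`-lattice on a three-dimensional positive definite quadratic
space over `ℚ`, assumed to be non-classic integral, i.e. its norm ideal (the `ℤ`-submodule of `ℚ`
generated by the values `Q(x)`, `x ∈ L`) is equal to `ℤ`. -/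
structure TernaryLattice : Type (u + 1) where
  /-- The underlying vector space of the ambient quadratic space. -/
  space : Type u
  [addCommGroup : AddCommGroup space]
  [module : Module ℚ space]
  finrank_eq : Module.finrank ℚ space = 3
  /-- The quadratic form of the ambient quadratic space. -/
  form : QuadraticForm ℚ space
  posDef : form.PosDef
  /-- The lattice itself. -/
  lattice : Submodule ℤ space
  [isLattice : lattice.IsLattice ℚ]
  norm_eq : Submodule.span ℤ (form '' (lattice : Set space)) = 1

namespace TernaryLattice

attribute [instance] addCommGroup module isLattice

/-- `L` and `K` are isometric: some isometry of the ambient spaces carries `L` onto `K`. -/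
def Isometric (L K : TernaryLattice.{u}) : Prop :=
  ∃ σ : L.form.IsometryEquiv K.form, σ '' (L.lattice : Set L.space) = (K.lattice : Set K.space)

/-- The number `r(n, L)` of representations of the integer `n` by `L`. -/
noncomputable def r (n : ℤ) (L : TernaryLattice.{u}) : ℕ :=
  Set.ncard {x : L.space | x ∈ L.lattice ∧ L.form x = (n : ℚ)}

/-- `m_s(L)`, the least positive integer `n` such that `n²` is represented by `L`
(and `0` when there is no such integer). -/
noncomputable def ms (L : TernaryLattice.{u}) : ℕ :=
  sInf {n : ℕ | 0 < n ∧ r ((n : ℤ) ^ 2) L ≠ 0}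

/-- The matrix `(B(xᵢ, xⱼ))` of a `ℤ`-basis `x₁, x₂, x₃` of `L`, where
`2 B(x, y) = Q(x + y) - Q(x) - Q(y)`, so that `B(x, x) = Q(x)`. -/
noncomputable def gram (L : TernaryLattice.{u}) (b : Module.Basis (Fin 3) ℤ L.lattice) :
    Matrix (Fin 3) (Fin 3) ℚ :=
  Matrix.of fun i j => QuadraticMap.polar L.form (b i) (b j) / 2

theorem exists_basis (L : TernaryLattice.{u}) : Nonempty (Module.Basis (Fin 3) ℤ L.lattice) := by
  have h : Module.finrank ℤ L.lattice = 3 := by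
    rw [← L.finrank_eq, Module.finrank, Submodule.IsLattice.rank' ℚ L.lattice, Module.finrank]
  exact ⟨Module.finBasisOfFinrankEq ℤ L.lattice h⟩

/-- The discriminant `dL = det (B(xᵢ, xⱼ))`; it does not depend on the basis, see `disc_eq`. -/
noncomputable def disc (L : TernaryLattice.{u}) : ℚ :=
  (L.gram L.exists_basis.some).det

theorem gram_change (L : TernaryLattice.{u}) (b c : Module.Basis (Fin 3) ℤ L.lattice) :
    L.gram c = ((b.toMatrix c).map (Int.cast : ℤ → ℚ)).transpose * L.gram b *
      (b.toMatrix c).map (Int.cast : ℤ → ℚ) := by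
  have hc : ∀ j, ((c j : L.lattice) : L.space) =
      ∑ i, ((b.toMatrix c i j : ℤ) : ℚ) • ((b i : L.lattice) : L.space) := by
    intro j
    have := congrArg (fun x : L.lattice => (x : L.space)) (b.sum_toMatrix_smul_self c j)
    simp only [Submodule.coe_sum, Submodule.coe_smul_of_tower] at this
    rw [← this]
    refine Finset.sum_congr rfl fun i _ => ?_
    rw [Int.cast_smul_eq_zsmul]
  ext i j
  have key : QuadraticMap.polar L.form (c i) (c j) = ∑ k, ∑ l, ((b.toMatrix c k i : ℤ) : ℚ) *
      ((b.toMatrix c l j : ℤ) : ℚ) * QuadraticMap.polar L.form (b k) (b l) := by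
    rw [← QuadraticMap.polarBilin_apply_apply, hc i, hc j]
    simp only [map_sum, map_smul, LinearMap.sum_apply, LinearMap.smul_apply, smul_eq_mul,
      QuadraticMap.polarBilin_apply_apply, Finset.mul_sum]
    rw [Finset.sum_comm]
    refine Finset.sum_congr rfl fun k _ => Finset.sum_congr rfl fun l _ => ?_
    ring
  simp only [gram, Matrix.of_apply, key, Matrix.mul_apply, Matrix.transpose_apply, Matrix.map_apply,
    Fin.sum_univ_three]
  ring

theorem disc_eq (L : TernaryLattice.{u}) (b : Module.Basis (Fin 3) ℤ L.lattice) :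
    L.disc = (L.gram b).det := by
  set c := L.exists_basis.some
  have h1 : (b.toMatrix c).det * (c.toMatrix b).det = 1 := by
    rw [← Matrix.det_mul, Module.Basis.toMatrix_mul_toMatrix_flip, Matrix.det_one]
  have h2 : ((b.toMatrix c).det) ^ 2 = 1 := by
    rcases Int.isUnit_iff.mp (IsUnit.of_mul_eq_one _ h1) with h | h <;> rw [h] <;> norm_num
  have h3 : ((b.toMatrix c).map (Int.cast : ℤ → ℚ)).det = ((b.toMatrix c).det : ℚ) :=
    (Int.cast_det (b.toMatrix c)).symm
  rw [disc, L.gram_change b c, Matrix.det_mul, Matrix.det_mul, Matrix.det_transpose, h3]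
  have h4 : ((b.toMatrix c).det : ℚ) ^ 2 = 1 := by exact_mod_cast h2
  linear_combination (L.gram b).det * h4

/-- The integer `4 · dL` (see `fourDisc_cast`). -/
noncomputable def fourDisc (L : TernaryLattice.{u}) : ℤ := (4 * L.disc).num

theorem form_integral (L : TernaryLattice.{u}) {x : L.space} (hx : x ∈ L.lattice) :
    ∃ a : ℤ, L.form x = a := by
  have h : L.form x ∈ (1 : Submodule ℤ ℚ) := by
    rw [← L.norm_eq]
    exact Submodule.subset_span ⟨x, hx, rfl⟩
  obtain ⟨a, ha⟩ := Submodule.mem_one.mp h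
  exact ⟨a, by simpa using ha.symm⟩

theorem fourDisc_cast (L : TernaryLattice.{u}) : (L.fourDisc : ℚ) = 4 * L.disc := by
  obtain ⟨b⟩ := L.exists_basis
  have hp : ∀ i j, ∃ a : ℤ, QuadraticMap.polar L.form (b i) (b j) = a := by
    intro i j
    obtain ⟨x, hx⟩ := L.form_integral (L.lattice.add_mem (b i).2 (b j).2)
    obtain ⟨y, hy⟩ := L.form_integral (b i).2
    obtain ⟨z, hz⟩ := L.form_integral (b j).2
    exact ⟨x - y - z, by simp [QuadraticMap.polar, hx, hy, hz]⟩
  have hd : ∀ i, ∃ a : ℤ, QuadraticMap.polar L.form (b i) (b i) = 2 * a := by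
    intro i
    obtain ⟨y, hy⟩ := L.form_integral (b i).2
    exact ⟨y, by rw [QuadraticMap.polar_self, hy]; simp⟩
  have hs : ∀ i j, QuadraticMap.polar L.form (b i) (b j) = QuadraticMap.polar L.form (b j) (b i) :=
    fun i j => QuadraticMap.polar_comm _ _ _
  have : ∃ N : ℤ, 4 * L.disc = N := by
    obtain ⟨x, hx⟩ := hd 0
    obtain ⟨y, hy⟩ := hd 1
    obtain ⟨z, hz⟩ := hd 2
    obtain ⟨s, h01⟩ := hp 0 1
    obtain ⟨t, h02⟩ := hp 0 2
    obtain ⟨w, h12⟩ := hp 1 2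
    refine ⟨4 * x * y * z + s * t * w - x * w ^ 2 - y * t ^ 2 - z * s ^ 2, ?_⟩
    rw [L.disc_eq b, Matrix.det_fin_three]
    simp only [gram, Matrix.of_apply, hs 1 0, hs 2 0, hs 2 1, hx, hy, hz, h01, h02, h12]
    push_cast
    ring
  obtain ⟨N, hN⟩ := this
  rw [fourDisc, hN, Rat.num_intCast]

end TernaryLattice

/-- For an odd prime `p` and `D = 4d`, the number
`h_p(d, l) = (p^(l+1) - 1)/(p - 1) - (-d/p) (p^l - 1)/(p - 1)`. Here `(-d/p)` is the Legendre symbol;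
it is `(-4d/p)`, and `jacobiSym` is the Legendre symbol at an odd prime. -/
noncomputable def localFactor (D : ℤ) (p l : ℕ) : ℚ :=
  ((p : ℚ) ^ (l + 1) - 1) / ((p : ℚ) - 1) -
    (jacobiSym (-D) p : ℚ) * (((p : ℚ) ^ l - 1) / ((p : ℚ) - 1))

namespace TernaryLattice

/-- `L` is strongly `s`-regular. The integer `8 dL` is `2 * L.fourDisc`. The product is over the
primes `p ∤ 8 dL`; the primes not dividing `n = n₁ n₂` contribute the factor `h_p(dL, 0) = 1`. -/
def StronglySRegular (L : TernaryLattice.{u}) : Prop :=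
  ∀ n₁ n₂ : ℕ, 0 < n₁ → 0 < n₂ →
    (∀ p : ℕ, p.Prime → p ∣ n₁ → (p : ℤ) ∣ 2 * L.fourDisc) →
    IsCoprime (n₂ : ℤ) (2 * L.fourDisc) →
    (r ((n₁ : ℤ) ^ 2 * (n₂ : ℤ) ^ 2) L : ℚ) = (r ((n₁ : ℤ) ^ 2) L : ℚ) *
      ∏ p ∈ (n₁ * n₂).primeFactors.filter (fun p : ℕ => ¬ (p : ℤ) ∣ 2 * L.fourDisc),
        localFactor L.fourDisc p ((n₁ * n₂).factorization p)

end TernaryLattice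

/-! Write `D = 4 dL`. Minimality of `m = m_s(L)` forces every prime factor of `m` to divide `8 dL`:
otherwise the part of `m` prime to `8 dL` could be dropped. For a prime `p ∤ 8 dL`, regularity with
`n₁ = m`, `n₂ = p` then gives `r(m²p²) = r(m²)(p + 1 - (-dL/p)) ≥ p`.

A plane cannot hold that many vectors. If vectors of norm `N = (pm)²` are coplanar, any three have
zero Gram determinant, which restricts the powers of `p` dividing their products; there are at most
`8(4m² + 1)` of them, whatever `p` is (`card_le_of_coplanar`). So for larger `p` the lattice
contains three independent vectors of norm `(pm)²`, whence `|D| ≤ 24 (pm)⁶`.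

Lattices with three independent vectors of a fixed norm fall into finitely many classes
(`finite_classes_of_linearIndependent`), so it remains to bound `p` independently of `L`. If many
small primes divide `D`, then `D` exceeds `24 (pm)⁶` for the first prime `p` that does not; hence a
suitable `p` is bounded (`exists_prime_not_dvd_bounded`). -/

open QuadraticMap

/-! ### Vectors of equal norm in a plane -/

section Plane

variable {V : Type*} [AddCommGroup V] [Module ℚ V] (Q : QuadraticForm ℚ V)

/-- The vanishing of the Gram determinant of three linearly dependent vectors of equal norm. -/
theorem gram_relation_of_dependent {x y z : V} {α β γ N : ℚ} (h : α • x + β • y + γ • z = 0)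
    (hne : α ≠ 0 ∨ β ≠ 0 ∨ γ ≠ 0) (hx : Q x = N) (hy : Q y = N) (hz : Q z = N) :
    4 * N ^ 3 + polar Q x y * polar Q x z * polar Q y z =
      N * (polar Q x y ^ 2 + polar Q x z ^ 2 + polar Q y z ^ 2) := by
  have key : ∀ w, α * polar Q x w + β * polar Q y w + γ * polar Q z w = 0 := by
    intro w
    have := congrArg (fun v => polar Q v w) h
    simpa [polar_add_left, polar_smul_left] using this
  have e1 := key x
  have e2 := key y
  have e3 := key z
  rw [polar_self, hx, polar_comm Q y x, polar_comm Q z x] at e1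
  rw [polar_self, hy, polar_comm Q z y] at e2
  rw [polar_self, hz] at e3
  simp only [nsmul_eq_mul, Nat.cast_ofNat] at e1 e2 e3
  generalize polar Q x y = a at *
  generalize polar Q x z = b at *
  generalize polar Q y z = c at *
  rcases hne with h | h | h
  -- Cramer's rule: the coefficients form a row of the adjugate of the Gram matrix `(polar)`, whose
  -- determinant is twice the difference of the two sides.
  · apply mul_left_cancel₀ h
    linear_combination (1 / 2) * ((4 * N ^ 2 - c ^ 2) * e1 + (b * c - 2 * N * a) * e2 +
      (a * c - 2 * N * b) * e3)
  · apply mul_left_cancel₀ h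
    linear_combination (1 / 2) * ((b * c - 2 * N * a) * e1 + (4 * N ^ 2 - b ^ 2) * e2 +
      (a * b - 2 * N * c) * e3)
  · apply mul_left_cancel₀ h
    linear_combination (1 / 2) * ((a * c - 2 * N * b) * e1 + (a * b - 2 * N * c) * e2 +
      (4 * N ^ 2 - a ^ 2) * e3)

variable {Q}

/-- In a plane, at most two vectors have a given norm and a given product with a fixed vector. -/
theorem eq_or_eq_or_eq_of_polar_eq (hQ : Q.PosDef) {W : Submodule ℚ V}
    (hW : ∀ x ∈ W, ∀ y ∈ W, ∀ z ∈ W, ∃ α β γ : ℚ, (α ≠ 0 ∨ β ≠ 0 ∨ γ ≠ 0) ∧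
      α • x + β • y + γ • z = 0)
    {x y₀ y₁ y₂ : V} (hx : x ∈ W) (hx0 : x ≠ 0) (h0 : y₀ ∈ W) (h1 : y₁ ∈ W) (h2 : y₂ ∈ W)
    (hQ1 : Q y₁ = Q y₀) (hQ2 : Q y₂ = Q y₀)
    (hp1 : polar Q x y₁ = polar Q x y₀) (hp2 : polar Q x y₂ = polar Q x y₀) :
    y₀ = y₁ ∨ y₀ = y₂ ∨ y₁ = y₂ := by
  -- The differences `u`, `w` are orthogonal to `x`, so in a plane they are proportional, and a line
  -- meets a level set of `Q` at most twice.
  obtain ⟨u, rfl⟩ : ∃ u, y₁ = y₀ + u := ⟨y₁ - y₀, by abel⟩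
  obtain ⟨w, rfl⟩ : ∃ w, y₂ = y₀ + w := ⟨y₂ - y₀, by abel⟩
  have hu : u ∈ W := by simpa using W.sub_mem h1 h0
  have hw : w ∈ W := by simpa using W.sub_mem h2 h0
  have hxu : polar Q x u = 0 := by simpa [polar_add_right] using hp1
  have hxw : polar Q x w = 0 := by simpa [polar_add_right] using hp2
  have hu' : Q u + polar Q y₀ u = 0 := by rw [polar]; linear_combination hQ1
  have hw' : Q w + polar Q y₀ w = 0 := by rw [polar]; linear_combination hQ2
  simp only [left_eq_add, add_right_inj]
  obtain ⟨α, β, γ, hne, h⟩ := hW x hx u hu w hw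
  have hα : α = 0 := by
    have := congrArg (fun v => polar Q x v) h
    simp only [polar_add_right, polar_smul_right, hxu, hxw, polar_self, polar_zero_right,
      smul_eq_mul, mul_zero, add_zero, mul_eq_zero, nsmul_eq_mul, Nat.cast_ofNat] at this
    rcases this with h | h | h
    · exact h
    · norm_num at h
    · exact absurd (hQ.anisotropic.eq_zero_iff.mp h) hx0
  subst hα
  rw [zero_smul, zero_add] at h
  by_cases hγ : γ = 0
  · subst hγ
    have hβ : β ≠ 0 := by simpa using hne
    left
    simpa [hβ] using h
  · obtain ⟨δ, rfl⟩ : ∃ δ : ℚ, w = δ • u := by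
      refine ⟨-(γ⁻¹ * β), ?_⟩
      have h' : γ • w = -(β • u) := by rw [eq_neg_iff_add_eq_zero, add_comm]; exact h
      rw [neg_smul, mul_smul, ← smul_neg, ← h', smul_smul, inv_mul_cancel₀ hγ, one_smul]
    rw [QuadraticMap.map_smul, polar_smul_right, smul_eq_mul, smul_eq_mul] at hw'
    have : δ * ((δ - 1) * Q u) = 0 := by linear_combination hw' - δ * hu'
    rcases mul_eq_zero.mp this with h | h
    · right; left; rw [h, zero_smul]
    · rcases mul_eq_zero.mp h with h | h
      · right; right; rw [sub_eq_zero.mp h, one_smul]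
      · left; exact hQ.anisotropic.eq_zero_iff.mp h

theorem abs_polar_le (hQ : Q.PosDef) {x y : V} {N : ℚ} (hx : Q x = N) (hy : Q y = N) :
    |polar Q x y| ≤ 2 * N := by
  have h1 : 0 ≤ Q (x + y) := hQ.nonneg _
  have h2 : 0 ≤ Q (x + -y) := hQ.nonneg _
  have h3 : polar Q x (-y) = -polar Q x y := polar_neg_right Q x y
  have h4 : polar Q x y = Q (x + y) - Q x - Q y := rfl
  have h5 : polar Q x (-y) = Q (x + -y) - Q x - Q (-y) := rfl
  rw [QuadraticMap.map_neg] at h5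
  rw [abs_le]
  constructor <;> linarith

end Plane

/-! ### Counting coplanar vectors of norm `(pm)²` by divisibility by `p` -/

/-- If `N = (pm)²` and `b₁, b₂` are prime to `p`, then the Gram relation forces `p² ∣ b₃`. -/
theorem sq_dvd_of_gram_relation {p m b₁ b₂ b₃ : ℤ} (hp : Prime p)
    (h : 4 * ((p * m) ^ 2) ^ 3 + b₁ * b₂ * b₃ = (p * m) ^ 2 * (b₁ ^ 2 + b₂ ^ 2 + b₃ ^ 2))
    (h1 : ¬ p ∣ b₁) (h2 : ¬ p ∣ b₂) : p ^ 2 ∣ b₃ := by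
  have hc : IsCoprime (p ^ 2) (b₁ * b₂) :=
    ((hp.coprime_iff_not_dvd.mpr h1).mul_right (hp.coprime_iff_not_dvd.mpr h2)).pow_left
  refine hc.dvd_of_dvd_mul_left ⟨m ^ 2 * (b₁ ^ 2 + b₂ ^ 2 + b₃ ^ 2) - 4 * p ^ 4 * m ^ 6, ?_⟩
  linear_combination h

/-- If `N = (pm)²`, `b₁, b₂` are exactly divisible by `p` and `p ∣ b₃`, then `p² ∣ b₃`. -/
theorem sq_dvd_of_gram_relation_of_dvd {p m b₁ b₂ b₃ : ℤ} (hp : Prime p)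
    (h : 4 * ((p * m) ^ 2) ^ 3 + b₁ * b₂ * b₃ = (p * m) ^ 2 * (b₁ ^ 2 + b₂ ^ 2 + b₃ ^ 2))
    (h1 : p ∣ b₁) (h1' : ¬ p ^ 2 ∣ b₁) (h2 : p ∣ b₂) (h2' : ¬ p ^ 2 ∣ b₂) (h3 : p ∣ b₃) :
    p ^ 2 ∣ b₃ := by
  obtain ⟨c₁, rfl⟩ := h1
  obtain ⟨c₂, rfl⟩ := h2
  obtain ⟨c₃, rfl⟩ := h3
  rw [pow_two, mul_dvd_mul_iff_left hp.ne_zero] at *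
  -- After division by `p³`, every term of the relation other than `c₁c₂c₃` still carries a factor
  -- `p`.
  have : p ∣ c₁ * c₂ * c₃ := by
    refine ⟨m ^ 2 * (c₁ ^ 2 + c₂ ^ 2 + c₃ ^ 2) - 4 * p ^ 2 * m ^ 6, ?_⟩
    apply mul_left_cancel₀ (pow_ne_zero 3 hp.ne_zero)
    linear_combination h
  rcases hp.dvd_or_dvd this with h | h
  · rcases hp.dvd_or_dvd h with h | h
    · exact absurd h h1'
    · exact absurd h h2'
  · exact h

section Count

variable {V : Type*} [AddCommGroup V] [Module ℚ V] {Q : QuadraticForm ℚ V}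

-- The products with `x` are `p²k` with `|k| ≤ 2m²` by `abs_polar_le`, so they take at most `4m² +
-- 1` values, and in a plane each value is shared by at most two vectors.
open Classical in
theorem card_le_of_polar_mem_sq (hQ : Q.PosDef) {W : Submodule ℚ V}
    (hW : ∀ x ∈ W, ∀ y ∈ W, ∀ z ∈ W, ∃ α β γ : ℚ, (α ≠ 0 ∨ β ≠ 0 ∨ γ ≠ 0) ∧
      α • x + β • y + γ • z = 0)
    {p m : ℕ} (hp : 0 < p) (hm : 0 < m) {A : Finset V} {x : V} (hx : x ∈ W)
    (hxN : Q x = ((p : ℚ) * m) ^ 2) (hA : ∀ y ∈ A, y ∈ W ∧ Q y = ((p : ℚ) * m) ^ 2)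
    (hAp : ∀ y ∈ A, ∃ k : ℤ, polar Q x y = (p : ℚ) ^ 2 * k) :
    A.card ≤ 2 * (4 * m ^ 2 + 1) := by
  have hx0 : x ≠ 0 := by
    rintro rfl
    rw [QuadraticMap.map_zero] at hxN
    exact absurd hxN (by positivity)
  set T : Finset ℚ := (Finset.Icc (-(2 * m ^ 2) : ℤ) (2 * m ^ 2)).image
    fun k : ℤ => (p : ℚ) ^ 2 * k
  have hT : T.card ≤ 4 * m ^ 2 + 1 := by
    refine Finset.card_image_le.trans ?_
    rw [Int.card_Icc, Int.toNat_le]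
    push_cast
    linarith
  refine (Finset.card_le_mul_card_image_of_maps_to (f := fun y => polar Q x y) (t := T)
    ?_ 2 ?_).trans (Nat.mul_le_mul_left 2 hT)
  · intro y hy
    obtain ⟨k, hk⟩ := hAp y hy
    have hb := abs_polar_le hQ hxN (hA y hy).2
    rw [hk, abs_mul, abs_of_nonneg (by positivity)] at hb
    have hk' : |(k : ℚ)| ≤ 2 * m ^ 2 := by
      have hp2 : (0 : ℚ) < (p : ℚ) ^ 2 := by positivity
      refine le_of_mul_le_mul_left ?_ hp2
      linarith [hb, mul_pow (p : ℚ) m 2]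
    have hk'' : |k| ≤ 2 * (m : ℤ) ^ 2 := by exact_mod_cast hk'
    exact Finset.mem_image.mpr ⟨k, Finset.mem_Icc.mpr (abs_le.mp hk''), hk.symm⟩
  · intro b _
    by_contra! hcard
    obtain ⟨y₀, h0, y₁, h1, y₂, h2, h01, h02, h12⟩ := Finset.two_lt_card.mp hcard
    rw [Finset.mem_filter] at h0 h1 h2
    have a0 := hA _ h0.1
    have a1 := hA _ h1.1
    have a2 := hA _ h2.1
    rcases eq_or_eq_or_eq_of_polar_eq hQ hW hx hx0 a0.1 a1.1 a2.1 (a1.2.trans a0.2.symm)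
      (a2.2.trans a0.2.symm) (h1.2.trans h0.2.symm) (h2.2.trans h0.2.symm) with h | h | h
    exacts [h01 h, h02 h, h12 h]

open Classical in
/-- A bound, independent of `p`, for the number of vectors of norm `(pm)²` in a plane. -/
theorem card_le_of_coplanar (hQ : Q.PosDef) {W : Submodule ℚ V}
    (hW : ∀ x ∈ W, ∀ y ∈ W, ∀ z ∈ W, ∃ α β γ : ℚ, (α ≠ 0 ∨ β ≠ 0 ∨ γ ≠ 0) ∧
      α • x + β • y + γ • z = 0)
    {p m : ℕ} (hp : p.Prime) (hm : 0 < m) {X : Finset V}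
    (hX : ∀ y ∈ X, y ∈ W ∧ Q y = ((p : ℚ) * m) ^ 2)
    (hint : ∀ x ∈ X, ∀ y ∈ X, ∃ b : ℤ, polar Q x y = b) :
    X.card ≤ 8 * (4 * m ^ 2 + 1) := by
  choose! b hb using hint
  have hpZ : Prime (p : ℤ) := Nat.prime_iff_prime_int.mp hp
  have rel : ∀ x ∈ X, ∀ y ∈ X, ∀ z ∈ X, 4 * (((p : ℤ) * m) ^ 2) ^ 3 + b x y * b x z * b y z =
      ((p : ℤ) * m) ^ 2 * (b x y ^ 2 + b x z ^ 2 + b y z ^ 2) := by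
    intro x hx y hy z hz
    obtain ⟨α, β, γ, hne, h⟩ := hW x (hX x hx).1 y (hX y hy).1 z (hX z hz).1
    have := gram_relation_of_dependent Q h hne (hX x hx).2 (hX y hy).2 (hX z hz).2
    rw [hb x hx y hy, hb x hx z hz, hb y hy z hz] at this
    exact_mod_cast this
  -- Relative to `x`, the vectors split into those with `p² ∣ b x y` (`A x`), those with `p ∤ b x y`
  -- (`Z x`), and those with `p` dividing exactly once.
  set A : V → Finset V := fun x => X.filter fun y => (p : ℤ) ^ 2 ∣ b x y with hAdef
  set Z : V → Finset V := fun x => X.filter fun y => ¬ (p : ℤ) ∣ b x y with hZdef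
  have hA : ∀ x ∈ X, (A x).card ≤ 2 * (4 * m ^ 2 + 1) := by
    intro x hx
    refine card_le_of_polar_mem_sq hQ hW hp.pos hm (hX x hx).1 (hX x hx).2
      (fun y hy => hX y (Finset.mem_filter.mp hy).1) fun y hy => ?_
    obtain ⟨hyX, k, hk⟩ := Finset.mem_filter.mp hy
    exact ⟨k, by rw [hb x hx y hyX, hk]; push_cast; ring⟩
  have hZ : ∀ x ∈ X, (Z x).card ≤ 2 * (4 * m ^ 2 + 1) := by
    intro x hx
    rcases (Z x).eq_empty_or_nonempty with h | ⟨y, hy⟩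
    · simp [h]
    · obtain ⟨hyX, hy'⟩ := Finset.mem_filter.mp hy
      -- The Gram relation puts all of `Z x` inside `A y` for any single `y ∈ Z x`.
      refine (Finset.card_le_card fun z hz => ?_).trans (hA y hyX)
      obtain ⟨hzX, hz'⟩ := Finset.mem_filter.mp hz
      exact Finset.mem_filter.mpr
        ⟨hzX, sq_dvd_of_gram_relation hpZ (rel x hx y hyX z hzX) hy' hz'⟩
  have hO : ∀ x ∈ X, (X \ (A x ∪ Z x)).card ≤ 4 * (4 * m ^ 2 + 1) := by
    intro x hx
    have mem : ∀ y ∈ X \ (A x ∪ Z x), y ∈ X ∧ (p : ℤ) ∣ b x y ∧ ¬ (p : ℤ) ^ 2 ∣ b x y := by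
      intro y hy
      simp only [hAdef, hZdef, Finset.mem_sdiff, Finset.mem_union, Finset.mem_filter] at hy
      tauto
    rcases (X \ (A x ∪ Z x)).eq_empty_or_nonempty with h | ⟨y, hy⟩
    · simp [h]
    · obtain ⟨hyX, hy1, hy2⟩ := mem y hy
      -- Exact divisibility of `b x y` and `b x z` excludes exact divisibility of `b y z`.
      have hsub : X \ (A x ∪ Z x) ⊆ A y ∪ Z y := by
        intro z hz
        obtain ⟨hzX, hz1, hz2⟩ := mem z hz
        rw [Finset.mem_union, Finset.mem_filter, Finset.mem_filter]
        by_cases h : (p : ℤ) ∣ b y z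
        · exact Or.inl ⟨hzX, sq_dvd_of_gram_relation_of_dvd hpZ (rel x hx y hyX z hzX)
            hy1 hy2 hz1 hz2 h⟩
        · exact Or.inr ⟨hzX, h⟩
      have := (Finset.card_le_card hsub).trans (Finset.card_union_le _ _)
      have := hA y hyX
      have := hZ y hyX
      omega
  rcases X.eq_empty_or_nonempty with h | ⟨x, hx⟩
  · simp [h]
  · have h1 : X.card ≤ (X \ (A x ∪ Z x)).card + (A x ∪ Z x).card := by
      rw [← Nat.sub_le_iff_le_add]
      exact Finset.le_card_sdiff _ _
    have := Finset.card_union_le (A x) (Z x)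
    have := hA x hx
    have := hZ x hx
    have := hO x hx
    omega

end Count

/-! ### Choice of the prime -/

/-- For every `c` there is a bound `B` such that each `D ≠ 0` has a prime `p > c` prime to `2D`
which is either bounded by `B` or small compared to `D`. -/
theorem exists_prime_not_dvd_bounded (c e : ℕ) :
    ∃ B : ℕ, ∀ D : ℕ, D ≠ 0 → ∃ p : ℕ, p.Prime ∧ c < p ∧ ¬ p ∣ 2 * D ∧
      (D ≤ e * p ^ 6 → p ≤ B) := by
  have step : ∀ n : ℕ, ∃ q : ℕ, n ≠ 0 → q.Prime ∧ n < q ∧ q ≤ 2 * n := fun n => by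
    by_cases h : n = 0
    · exact ⟨0, fun h' => absurd h h'⟩
    · obtain ⟨q, hq⟩ := Nat.exists_prime_lt_and_le_two_mul n h
      exact ⟨q, fun _ => hq⟩
  choose f hf using step
  -- Primes above `128 = 2⁷` are wanted: a product of `k` of them is at least `2^(7k)`, which
  -- outgrows the sixth power `2^(6k) q₀⁶` bounding `q k ^ 6`. Bertrand's postulate supplies the
  -- chain `q i ≤ 2^i q₀`.
  obtain ⟨q₀, hq₀, hq₀p⟩ := Nat.exists_infinite_primes (c + 129)
  set q : ℕ → ℕ := fun i => f^[i] q₀ with hq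
  have hsucc : ∀ i, q (i + 1) = f (q i) := fun i => Function.iterate_succ_apply' f i q₀
  have hprime : ∀ i, (q i).Prime := by
    intro i
    induction i with
    | zero => exact hq₀p
    | succ i ih => rw [hsucc]; exact (hf _ ih.ne_zero).1
  have hmono : StrictMono q := strictMono_nat_of_lt_succ fun i => by
    rw [hsucc]; exact (hf _ (hprime i).ne_zero).2.1
  have hge : ∀ i, q₀ ≤ q i := fun i => hmono.monotone (Nat.zero_le i)
  have hle : ∀ i, q i ≤ 2 ^ i * q₀ := by
    intro i
    induction i with
    | zero => simp [hq]
    | succ i ih =>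
      rw [hsucc, pow_succ]
      have := (hf _ (hprime i).ne_zero).2.2
      linarith
  refine ⟨2 ^ (e * q₀ ^ 6) * q₀, fun D hD => ?_⟩
  have hex : ∃ k, ¬ q k ∣ D := by
    refine ⟨D, fun h => ?_⟩
    have h1 := Nat.le_of_dvd (Nat.pos_of_ne_zero hD) h
    have h2 : D + q 0 ≤ q D := by simpa using hmono.add_le_nat D 0
    have := (hprime 0).pos
    omega
  classical
  set k := Nat.find hex
  have hk : ¬ q k ∣ D := Nat.find_spec hex
  have hlt : ∀ i < k, q i ∣ D := fun i hi => not_not.mp (Nat.find_min hex hi)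
  refine ⟨q k, hprime k, by have := hge k; omega, fun h => ?_, fun h => ?_⟩
  · rcases (hprime k).dvd_mul.mp h with h | h
    · have := Nat.le_of_dvd two_pos h
      have := hge k
      omega
    · exact hk h
  · have hprod : ∏ i ∈ Finset.range k, q i ∣ D :=
      Finset.prod_dvd_of_isRelPrime
        (fun i _ j _ hij => (Nat.coprime_iff_isRelPrime.mp ((Nat.coprime_primes (hprime i)
          (hprime j)).mpr (hmono.injective.ne hij))))
        fun i hi => hlt i (Finset.mem_range.mp hi)
    have h128 : 128 ^ k ≤ ∏ i ∈ Finset.range k, q i := by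
      have := Finset.pow_card_le_prod (Finset.range k) q 128
        (fun i _ => by have := hge i; omega)
      simpa using this
    have hD' : 128 ^ k ≤ e * (2 ^ k * q₀) ^ 6 :=
      h128.trans ((Nat.le_of_dvd (Nat.pos_of_ne_zero hD) hprod).trans
        (h.trans (Nat.mul_le_mul_left e (Nat.pow_le_pow_left (hle k) 6))))
    -- Cancelling `64^k` from `hD'` leaves a bound on `k` that does not involve `D`.
    have h2k : 2 ^ k ≤ e * q₀ ^ 6 := by
      have e1 : (128 : ℕ) ^ k = 2 ^ k * 64 ^ k := by rw [← mul_pow]; norm_num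
      have e2 : (2 ^ k * q₀) ^ 6 = q₀ ^ 6 * 64 ^ k := by
        rw [mul_pow, ← pow_mul, mul_comm k 6, pow_mul]; norm_num [mul_comm]
      rw [e1, e2, ← mul_assoc] at hD'
      exact Nat.le_of_mul_le_mul_right hD' (by positivity)
    exact (hle k).trans (Nat.mul_le_mul_right _ (Nat.pow_le_pow_right two_pos
      ((Nat.lt_two_pow_self).le.trans h2k)))

/-! ### Sublattices spanned by three vectors: isometry and index -/

/-- A linear isomorphism matching the Gram matrices of two bases is an isometry. -/
theorem form_eq_of_polar_basis_eq {V V' : Type*} [AddCommGroup V] [Module ℚ V] [AddCommGroup V']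
    [Module ℚ V'] {Q : QuadraticForm ℚ V} {Q' : QuadraticForm ℚ V'} {ι : Type*}
    (b : Module.Basis ι ℚ V) (σ : V →ₗ[ℚ] V')
    (h : ∀ i j, polar Q' (σ (b i)) (σ (b j)) = polar Q (b i) (b j)) (x : V) :
    Q' (σ x) = Q x := by
  have key : Q'.polarBilin.compl₁₂ σ σ = Q.polarBilin := by
    refine LinearMap.ext_basis b b fun i j => ?_
    simpa using h i j
  have := congrArg (fun B => B x x) key
  simp only [LinearMap.compl₁₂_apply, polarBilin_apply_apply, polar_self, nsmul_eq_mul] at this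
  exact mul_left_cancel₀ (by norm_num) this

namespace TernaryLattice

theorem exists_polar_eq (L : TernaryLattice.{u}) {x y : L.space} (hx : x ∈ L.lattice)
    (hy : y ∈ L.lattice) : ∃ a : ℤ, polar L.form x y = a := by
  obtain ⟨a, ha⟩ := L.form_integral (L.lattice.add_mem hx hy)
  obtain ⟨b, hb⟩ := L.form_integral hx
  obtain ⟨c, hc⟩ := L.form_integral hy
  exact ⟨a - b - c, by simp [polar, ha, hb, hc]⟩

/-- The classes modulo `kℤ³` of the coordinate vectors `z` with `∑ (zᵢ / k) vᵢ ∈ L`. -/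
def residues (L : TernaryLattice.{u}) (v : Fin 3 → L.space) (k : ℕ) : Set (Fin 3 → ZMod k) :=
  {w | ∃ z : Fin 3 → ℤ, (∀ i, (z i : ZMod k) = w i) ∧
    ∑ i, ((z i : ℚ) / k) • v i ∈ L.lattice}

/-- Coordinate vectors with the same residues differ by an element of `kℤ³`, that is, by an integral
combination of the `v' i`, which lies in `L'`. -/
theorem sum_mem_of_residues_eq {L L' : TernaryLattice.{u}} {v : Fin 3 → L.space}
    {v' : Fin 3 → L'.space} {k : ℕ} (hk : k ≠ 0) (hv' : ∀ i, v' i ∈ L'.lattice)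
    (h : L.residues v k = L'.residues v' k) {z : Fin 3 → ℤ}
    (hz : ∑ i, ((z i : ℚ) / k) • v i ∈ L.lattice) :
    ∑ i, ((z i : ℚ) / k) • v' i ∈ L'.lattice := by
  have hmem : (fun i => (z i : ZMod k)) ∈ L'.residues v' k := h ▸ ⟨z, fun _ => rfl, hz⟩
  obtain ⟨w, hw, hwL⟩ := hmem
  have hdvd : ∀ i, ∃ t : ℤ, z i = w i + k * t := fun i => by
    obtain ⟨t, ht⟩ := (ZMod.intCast_eq_intCast_iff_dvd_sub _ _ k).mp (hw i)
    exact ⟨t, by linarith⟩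
  choose t ht using hdvd
  have : ∑ i, ((z i : ℚ) / k) • v' i = ∑ i, ((w i : ℚ) / k) • v' i + ∑ i, t i • v' i := by
    rw [← Finset.sum_add_distrib]
    refine Finset.sum_congr rfl fun i _ => ?_
    rw [← Int.cast_smul_eq_zsmul ℚ, ← add_smul, ht i]
    congr 1
    push_cast
    field_simp
  rw [this]
  exact L'.lattice.add_mem hwL (L'.lattice.sum_mem fun i _ => L'.lattice.smul_mem _ (hv' i))

/-- Lattices with the same data `(Gram matrix of v, L / ℤv)` are isometric. -/
theorem isometric_of_residues_eq {L L' : TernaryLattice.{u}} {v : Fin 3 → L.space}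
    {v' : Fin 3 → L'.space} {k : ℕ} (hk : k ≠ 0) (hv : LinearIndependent ℚ v)
    (hv' : LinearIndependent ℚ v') (hvL : ∀ i, v i ∈ L.lattice) (hvL' : ∀ i, v' i ∈ L'.lattice)
    (hvk : ∀ x ∈ L.lattice, ∃ z : Fin 3 → ℤ, x = ∑ i, ((z i : ℚ) / k) • v i)
    (hvk' : ∀ x ∈ L'.lattice, ∃ z : Fin 3 → ℤ, x = ∑ i, ((z i : ℚ) / k) • v' i)
    (hpolar : ∀ i j, polar L.form (v i) (v j) = polar L'.form (v' i) (v' j))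
    (h : L.residues v k = L'.residues v' k) : L.Isometric L' := by
  set b := basisOfLinearIndependentOfCardEqFinrank hv (by simp [L.finrank_eq]) with hb
  set b' := basisOfLinearIndependentOfCardEqFinrank hv' (by simp [L'.finrank_eq]) with hb'
  have hbv : ∀ i, b i = v i := fun i => by simp [hb]
  have hbv' : ∀ i, b' i = v' i := fun i => by simp [hb']
  set σ := b.equiv b' (Equiv.refl _)
  have hσ : ∀ i, σ (v i) = v' i := fun i => by
    rw [← hbv, ← hbv', Module.Basis.equiv_apply, Equiv.refl_apply]
  have hσsum : ∀ c : Fin 3 → ℚ, σ (∑ i, c i • v i) = ∑ i, c i • v' i := fun c => by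
    simp only [map_sum, map_smul, hσ]
  refine ⟨⟨σ, fun x => form_eq_of_polar_basis_eq b (σ : L.space →ₗ[ℚ] L'.space)
    (fun i j => ?_) x⟩, ?_⟩
  · simp only [hbv, LinearEquiv.coe_coe, hσ, hpolar]
  · apply Set.eq_of_subset_of_subset
    · rintro _ ⟨x, hx, rfl⟩
      obtain ⟨z, rfl⟩ := hvk x hx
      change σ _ ∈ L'.lattice
      rw [hσsum]
      exact sum_mem_of_residues_eq hk hvL' h hx
    · intro y hy
      obtain ⟨z, rfl⟩ := hvk' y hy
      exact ⟨_, sum_mem_of_residues_eq hk hvL h.symm hy, hσsum _⟩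

/-- The relation between the discriminant of `L` and that of a full sublattice `ℤv`, together with
the inclusion `[L : ℤv] L ⊆ ℤv`. -/
theorem exists_index (L : TernaryLattice.{u}) {v : Fin 3 → L.space} (hv : LinearIndependent ℚ v)
    (hvL : ∀ i, v i ∈ L.lattice) :
    ∃ d : ℤ, d ≠ 0 ∧
      (Matrix.of fun i j => polar L.form (v i) (v j) / 2).det = (d : ℚ) ^ 2 * L.disc ∧
      ∀ x ∈ L.lattice, ∃ z : Fin 3 → ℤ, d • x = ∑ i, z i • v i := by
  obtain ⟨b⟩ := L.exists_basis
  set w : Fin 3 → L.lattice := fun i => ⟨v i, hvL i⟩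
  set T : Matrix (Fin 3) (Fin 3) ℤ := b.toMatrix w with hT
  have hsum : ∀ z : Fin 3 → ℤ, ∑ j, z j • w j = ∑ i, (T.mulVec z) i • b i := by
    intro z
    apply b.ext_elem
    intro i
    rw [b.repr_sum_self]
    simp only [map_sum, map_smul, Finsupp.coe_finsetSum, Finsupp.coe_smul, Finset.sum_apply,
      Pi.smul_apply, smul_eq_mul, Matrix.mulVec, dotProduct, hT, Module.Basis.toMatrix_apply]
    exact Finset.sum_congr rfl fun j _ => mul_comm _ _
  -- The integer `d` is the determinant of the coordinates of `v` in a basis, the index up to sign;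
  -- `T * adjugate T = d` gives the inclusion.
  refine ⟨T.det, fun h0 => ?_, ?_, fun x hx => ?_⟩
  · obtain ⟨z, hz0, hz⟩ := Matrix.exists_mulVec_eq_zero_iff.mpr h0
    have h1 := hsum z
    simp only [hz, Pi.zero_apply, zero_smul, Finset.sum_const_zero] at h1
    have h2 : ∑ j, (z j : ℚ) • v j = 0 := by
      have := congrArg (fun x : L.lattice => (x : L.space)) h1
      simp only [Submodule.coe_sum, Submodule.coe_smul_of_tower, Submodule.coe_zero, w] at this
      simpa only [Int.cast_smul_eq_zsmul] using this
    have h3 := Fintype.linearIndependent_iff.mp hv _ h2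
    exact hz0 (funext fun i => by simpa using h3 i)
  · have hc : ∀ j, v j = ∑ i, (T i j : ℚ) • ((b i : L.lattice) : L.space) := by
      intro j
      have := congrArg (fun x : L.lattice => (x : L.space)) (b.sum_toMatrix_smul_self w j)
      simp only [Submodule.coe_sum, Submodule.coe_smul_of_tower] at this
      change _ = v j at this
      rw [← this]
      exact Finset.sum_congr rfl fun i _ => (Int.cast_smul_eq_zsmul ℚ _ _).symm
    have hgram : (Matrix.of fun i j => polar L.form (v i) (v j) / 2) =
        (T.map (Int.cast : ℤ → ℚ)).transpose * L.gram b * T.map (Int.cast : ℤ → ℚ) := by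
      ext i j
      have key : polar L.form (v i) (v j) = ∑ k, ∑ l, (T k i : ℚ) * (T l j : ℚ) *
          polar L.form (b k) (b l) := by
        rw [← polarBilin_apply_apply, hc i, hc j]
        simp only [map_sum, map_smul, LinearMap.sum_apply, LinearMap.smul_apply, smul_eq_mul,
          polarBilin_apply_apply, Finset.mul_sum]
        rw [Finset.sum_comm]
        refine Finset.sum_congr rfl fun k _ => Finset.sum_congr rfl fun l _ => ?_
        ring
      simp only [gram, Matrix.of_apply, key, Matrix.mul_apply, Matrix.transpose_apply,
        Matrix.map_apply, Fin.sum_univ_three]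
      ring
    have h3 : (T.map (Int.cast : ℤ → ℚ)).det = (T.det : ℚ) := (Int.cast_det T).symm
    rw [hgram, Matrix.det_mul, Matrix.det_mul, Matrix.det_transpose, h3, ← L.disc_eq b]
    ring
  · refine ⟨T.adjugate.mulVec fun i => b.repr ⟨x, hx⟩ i, ?_⟩
    have h1 := hsum (T.adjugate.mulVec fun i => b.repr ⟨x, hx⟩ i)
    rw [Matrix.mulVec_mulVec, Matrix.mul_adjugate, Matrix.smul_mulVec, Matrix.one_mulVec] at h1
    simp only [Pi.smul_apply, smul_assoc, ← Finset.smul_sum, b.sum_repr] at h1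
    have := congrArg (fun x : L.lattice => (x : L.space)) h1
    simp only [Submodule.coe_sum, Submodule.coe_smul_of_tower, w] at this
    exact this.symm

/-- A kernel vector of the Gram matrix would be orthogonal to the whole lattice, hence to itself,
against positive definiteness. -/
theorem disc_ne_zero (L : TernaryLattice.{u}) : L.disc ≠ 0 := by
  obtain ⟨b⟩ := L.exists_basis
  rw [L.disc_eq b]
  intro h0
  obtain ⟨z, hz0, hz⟩ := Matrix.exists_mulVec_eq_zero_iff.mpr h0
  have expand : ∀ y, polar L.form y (∑ j, z j • ((b j : L.lattice) : L.space)) =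
      ∑ j, z j * polar L.form y (b j) := by
    intro y
    rw [← polarBilin_apply_apply, map_sum]
    exact Finset.sum_congr rfl fun j _ => by rw [map_smul]; rfl
  have hbx : ∀ i, polar L.form (b i) (∑ j, z j • ((b j : L.lattice) : L.space)) = 0 := by
    intro i
    have := congrFun hz i
    simp only [Matrix.mulVec, dotProduct, gram, Matrix.of_apply, Pi.zero_apply,
      Fin.sum_univ_three] at this
    rw [expand, Fin.sum_univ_three]
    linear_combination 2 * this
  have hxx : polar L.form (∑ j, z j • ((b j : L.lattice) : L.space))
      (∑ j, z j • ((b j : L.lattice) : L.space)) = 0 := by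
    rw [expand]
    exact Finset.sum_eq_zero fun j _ => by rw [polar_comm, hbx, mul_zero]
  rw [polar_self, two_nsmul, add_self_eq_zero, L.posDef.anisotropic.eq_zero_iff] at hxx
  have hli : LinearIndependent ℚ fun i => ((b i : L.lattice) : L.space) :=
    (LinearIndependent.iff_fractionRing ℤ ℚ).mp
      (b.linearIndependent.map' L.lattice.subtype (Submodule.ker_subtype _))
  exact hz0 (funext (Fintype.linearIndependent_iff.mp hli z hxx))

end TernaryLattice

/-! ### Finiteness for lattices with three independent vectors of norm `N` -/

namespace TernaryLattice

/-- Each entry is at most `N` in absolute value, and a `3 × 3` determinant has six terms. -/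
theorem abs_gram_det_le {L : TernaryLattice.{u}} {v : Fin 3 → L.space} {N : ℕ}
    (hN : ∀ i, L.form (v i) = N) :
    |(Matrix.of fun i j => polar L.form (v i) (v j) / 2).det| ≤ 6 * (N : ℚ) ^ 3 := by
  have h := Matrix.det_le (A := Matrix.of fun i j => polar L.form (v i) (v j) / 2)
    (abv := AbsoluteValue.abs) (x := (N : ℚ)) (fun i j => by
      have := abs_polar_le L.posDef (hN i) (hN j)
      simp only [Matrix.of_apply, AbsoluteValue.abs_apply, abs_div, abs_two]
      linarith)
  simpa [Nat.factorial] using h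

theorem fourDisc_ne_zero (L : TernaryLattice.{u}) : L.fourDisc ≠ 0 := fun h =>
  L.disc_ne_zero (by
    have := L.fourDisc_cast
    rw [h] at this
    simpa using this.symm)

/-- A sublattice `ℤv` generated by three independent vectors of norm `N` has bounded index. -/
theorem exists_index_le {L : TernaryLattice.{u}} {v : Fin 3 → L.space} {N : ℕ}
    (hv : LinearIndependent ℚ v) (hvL : ∀ i, v i ∈ L.lattice) (hN : ∀ i, L.form (v i) = N) :
    ∃ d : ℤ, d ≠ 0 ∧ d.natAbs ^ 2 * L.fourDisc.natAbs ≤ 24 * N ^ 3 ∧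
      ∀ x ∈ L.lattice, ∃ z : Fin 3 → ℤ, d • x = ∑ i, z i • v i := by
  obtain ⟨d, hd0, hd, hdz⟩ := L.exists_index hv hvL
  refine ⟨d, hd0, ?_, hdz⟩
  have h := abs_gram_det_le hN
  rw [hd, abs_mul, abs_of_nonneg (sq_nonneg _)] at h
  have h4 : |(L.fourDisc : ℚ)| = 4 * |L.disc| := by
    rw [L.fourDisc_cast, abs_mul]; norm_num
  have : (d : ℚ) ^ 2 * |(L.fourDisc : ℚ)| ≤ 24 * (N : ℚ) ^ 3 := by
    rw [h4]; linarith
  zify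
  rw [sq_abs]
  exact_mod_cast this

theorem natAbs_fourDisc_le {L : TernaryLattice.{u}} {v : Fin 3 → L.space} {N : ℕ}
    (hv : LinearIndependent ℚ v) (hvL : ∀ i, v i ∈ L.lattice) (hN : ∀ i, L.form (v i) = N) :
    L.fourDisc.natAbs ≤ 24 * N ^ 3 := by
  obtain ⟨d, hd0, hd, -⟩ := exists_index_le hv hvL hN
  exact (Nat.le_mul_of_pos_left _ (pow_pos (Int.natAbs_pos.mpr hd0) 2)).trans hd

/-- There are finitely many classes of ternary lattices containing three independent vectors of
norm `N`. -/
theorem finite_classes_of_linearIndependent (N : ℕ) :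
    ∃ S : Set TernaryLattice.{u}, S.Finite ∧ ∀ L : TernaryLattice.{u},
      (∃ v : Fin 3 → L.space, LinearIndependent ℚ v ∧ (∀ i, v i ∈ L.lattice) ∧
        ∀ i, L.form (v i) = N) → ∃ K ∈ S, L.Isometric K := by
  classical
  -- A common multiple of all possible indices, so that `L ⊆ (1/k) ℤv` uniformly in `L`.
  set k := (24 * N ^ 3).factorial with hk
  have hk0 : k ≠ 0 := Nat.factorial_ne_zero _
  have : NeZero k := ⟨hk0⟩
  -- A lattice is encoded by the products of the `v i` and by `L / ℤv` inside `(ℤ/k)³`. There are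
  -- finitely many codes, and the code determines the class.
  let Code := (Fin 3 → Fin 3 → Set.Icc (-(2 * N : ℤ)) (2 * N)) × Set (Fin 3 → ZMod k)
  let R : TernaryLattice.{u} → Code → Prop := fun L c =>
    ∃ v : Fin 3 → L.space, LinearIndependent ℚ v ∧ (∀ i, v i ∈ L.lattice) ∧
      (∀ x ∈ L.lattice, ∃ z : Fin 3 → ℤ, x = ∑ i, ((z i : ℚ) / k) • v i) ∧
      (∀ i j, polar L.form (v i) (v j) = ((c.1 i j : ℤ) : ℚ)) ∧ L.residues v k = c.2
  have hR : ∀ L K c, R L c → R K c → L.Isometric K := by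
    rintro L K c ⟨v, h1, h2, h3, h4, h5⟩ ⟨w, g1, g2, g3, g4, g5⟩
    exact isometric_of_residues_eq hk0 h1 g1 h2 g2 h3 g3
      (fun i j => (h4 i j).trans (g4 i j).symm) (h5.trans g5.symm)
  refine ⟨Set.range fun c : {c : Code // ∃ L, R L c} => c.2.choose, Set.finite_range _, ?_⟩
  rintro L ⟨v, hv, hvL, hvN⟩
  suffices h : ∃ c, R L c by
    obtain ⟨c, hc⟩ := h
    exact ⟨_, ⟨⟨c, L, hc⟩, rfl⟩, hR _ _ c hc (⟨L, hc⟩ : ∃ L, R L c).choose_spec⟩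
  choose a ha using fun i j => L.exists_polar_eq (hvL i) (hvL j)
  refine ⟨⟨fun i j => ⟨a i j, abs_le.mp ?_⟩, L.residues v k⟩, v, hv, hvL, ?_, ha, rfl⟩
  · have := abs_polar_le L.posDef (hvN i) (hvN j)
    rw [ha] at this
    exact_mod_cast this
  · obtain ⟨d, hd0, hd, hdz⟩ := exists_index_le hv hvL hvN
    have hdvd : d ∣ (k : ℤ) := by
      rw [← Int.natAbs_dvd_natAbs, Int.natAbs_natCast]
      have hdp := Int.natAbs_pos.mpr hd0
      refine Nat.dvd_factorial hdp ((Nat.le_self_pow two_ne_zero _).trans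
        ((Nat.le_mul_of_pos_right _ (Int.natAbs_pos.mpr L.fourDisc_ne_zero)).trans hd))
    obtain ⟨t, ht⟩ := hdvd
    intro x hx
    obtain ⟨z, hz⟩ := hdz x hx
    refine ⟨fun i => t * z i, ?_⟩
    have hkq : (k : ℚ) ≠ 0 := Nat.cast_ne_zero.mpr hk0
    apply smul_right_injective _ hkq
    have e1 : (k : ℚ) • x = (t : ℤ) • d • x := by
      rw [smul_smul, ← Int.cast_smul_eq_zsmul ℚ, mul_comm, ← ht, Int.cast_natCast]
    simp only [e1, hz, Finset.smul_sum]
    refine Finset.sum_congr rfl fun i _ => ?_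
    rw [smul_smul, smul_smul, ← Int.cast_smul_eq_zsmul ℚ]
    congr 1
    push_cast
    field_simp

/-! ### Independent or coplanar vectors of norm `(pm)²` -/

/-- A set that contains no three independent vectors lies in a plane. -/
theorem exists_linearIndependent_or_coplanar (L : TernaryLattice.{u}) (X : Set L.space) :
    (∃ v : Fin 3 → L.space, LinearIndependent ℚ v ∧ ∀ i, v i ∈ X) ∨
      ∃ W : Submodule ℚ L.space, X ⊆ W ∧ ∀ x ∈ W, ∀ y ∈ W, ∀ z ∈ W, ∃ α β γ : ℚ,
        (α ≠ 0 ∨ β ≠ 0 ∨ γ ≠ 0) ∧ α • x + β • y + γ • z = 0 := by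
  have : Module.Finite ℚ L.space := Module.finite_of_finrank_eq_succ L.finrank_eq
  by_cases h : Module.finrank ℚ (Submodule.span ℚ X) = 3
  · left
    obtain ⟨f, hf, -, hli⟩ := Submodule.exists_fun_fin_finrank_span_eq ℚ X
    exact ⟨f ∘ Fin.cast h.symm, hli.comp _ (Fin.cast_injective _), fun i => hf _⟩
  · right
    refine ⟨Submodule.span ℚ X, Submodule.subset_span, fun x hx y hy z hz => ?_⟩
    have hle := Submodule.finrank_le (Submodule.span ℚ X)
    rw [L.finrank_eq] at hle
    have hnli : ¬ LinearIndependent ℚ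
        (![⟨x, hx⟩, ⟨y, hy⟩, ⟨z, hz⟩] : Fin 3 → Submodule.span ℚ X) := fun hli => by
      have := hli.fintype_card_le_finrank
      rw [Fintype.card_fin] at this
      omega
    obtain ⟨g, hg, i, hi⟩ := Fintype.not_linearIndependent_iff.mp hnli
    refine ⟨g 0, g 1, g 2, ?_, ?_⟩
    · fin_cases i <;> simp_all
    · have := congrArg (fun w : Submodule.span ℚ X => (w : L.space)) hg
      simpa [Fin.sum_univ_three] using this

/-- The number of vectors of norm `(pm)²` in a coplanar set is bounded independently of `p`. -/
theorem r_le_of_coplanar {L : TernaryLattice.{u}} {p m : ℕ} (hp : p.Prime) (hm : 0 < m)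
    (h : ¬ ∃ v : Fin 3 → L.space, LinearIndependent ℚ v ∧ (∀ i, v i ∈ L.lattice) ∧
      ∀ i, L.form (v i) = (((p * m) ^ 2 : ℕ) : ℚ)) :
    r ((m : ℤ) ^ 2 * (p : ℤ) ^ 2) L ≤ 8 * (4 * m ^ 2 + 1) := by
  set X := {x : L.space | x ∈ L.lattice ∧ L.form x = (((m : ℤ) ^ 2 * (p : ℤ) ^ 2 : ℤ) : ℚ)}
    with hX
  change X.ncard ≤ _
  have hXN : ∀ x ∈ X, L.form x = ((p : ℚ) * m) ^ 2 := fun x hx => by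
    rw [hx.2]; push_cast; ring
  by_cases hfin : X.Finite
  swap
  -- `Set.ncard` is `0` on an infinite set, so the bound is then trivial.
  · simp [Set.Infinite.ncard hfin]
  rcases L.exists_linearIndependent_or_coplanar X with ⟨v, hv, hvX⟩ | ⟨W, hXW, hW⟩
  · refine absurd ⟨v, hv, fun i => (hvX i).1, fun i => ?_⟩ h
    rw [hXN _ (hvX i)]; push_cast; ring
  · rw [Set.ncard_eq_toFinset_card X hfin]
    refine card_le_of_coplanar L.posDef hW hp hm (fun y hy => ?_) fun x hx y hy => ?_
    · rw [Set.Finite.mem_toFinset] at hy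
      exact ⟨hXW hy, hXN y hy⟩
    · rw [Set.Finite.mem_toFinset] at hx hy
      exact L.exists_polar_eq hx.1 hy.1

/-! ### Consequences of strong `s`-regularity -/

/-- Since `sInf ∅ = 0`, positivity of `L.ms` means that the minimum is attained. -/
theorem r_ms_sq_ne_zero {L : TernaryLattice.{u}} (h : 0 < L.ms) : r ((L.ms : ℤ) ^ 2) L ≠ 0 :=
  (Nat.sInf_mem (Nat.nonempty_of_pos_sInf h)).2

/-- For a strongly `s`-regular lattice, every prime factor of `m_s(L)` divides `8dL`. -/
theorem StronglySRegular.dvd_of_dvd_ms {L : TernaryLattice.{u}} (hL : L.StronglySRegular)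
    (h : 0 < L.ms) {q : ℕ} (hq : q.Prime) (hqm : q ∣ L.ms) : (q : ℤ) ∣ 2 * L.fourDisc := by
  classical
  by_contra hqD
  set P := fun p : ℕ => (p : ℤ) ∣ 2 * L.fourDisc
  set g := fun p => p ^ L.ms.factorization p
  -- The factorization `m_s(L) = n₁n₂` separates the primes dividing `8dL` from the others. The
  -- regularity formula shows that `n₁²` is already represented, so minimality gives `n₂ = 1`.
  set n₁ := ∏ p ∈ L.ms.primeFactors.filter P, g p with hn₁
  set n₂ := ∏ p ∈ L.ms.primeFactors.filter (fun p => ¬ P p), g p with hn₂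
  have hmul : n₁ * n₂ = L.ms := by
    rw [hn₁, hn₂, Finset.prod_filter_mul_prod_filter_not]
    exact Nat.prod_factorization_pow_eq_self h.ne'
  have h1 : 0 < n₁ := Nat.pos_of_ne_zero fun h0 => h.ne' (by rw [← hmul, h0, zero_mul])
  have h2 : 0 < n₂ := Nat.pos_of_ne_zero fun h0 => h.ne' (by rw [← hmul, h0, mul_zero])
  have hd1 : ∀ p : ℕ, p.Prime → p ∣ n₁ → P p := by
    intro p hp hpn
    obtain ⟨p', hp', hpp'⟩ := (hp.prime.dvd_finsetProd_iff _).mp hpn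
    rw [Finset.mem_filter, Nat.mem_primeFactors] at hp'
    rw [(Nat.prime_dvd_prime_iff_eq hp hp'.1.1).mp (hp.dvd_of_dvd_pow hpp')]
    exact hp'.2
  have hd2 : IsCoprime (n₂ : ℤ) (2 * L.fourDisc) := by
    rw [hn₂, Nat.cast_prod]
    refine IsCoprime.prod_left fun p hp => ?_
    rw [Finset.mem_filter, Nat.mem_primeFactors] at hp
    rw [Nat.cast_pow]
    exact ((Nat.prime_iff_prime_int.mp hp.1.1).coprime_iff_not_dvd.mpr hp.2).pow_left
  have key := hL n₁ n₂ h1 h2 hd1 hd2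
  have hr1 : r ((n₁ : ℤ) ^ 2) L ≠ 0 := by
    intro h0
    rw [h0, Nat.cast_zero, zero_mul, ← mul_pow, ← Nat.cast_mul, hmul, Nat.cast_eq_zero] at key
    exact r_ms_sq_ne_zero h key
  have hle : L.ms ≤ n₁ := Nat.sInf_le ⟨h1, hr1⟩
  have hn2 : n₂ = 1 := by
    rw [← hmul] at hle
    have : n₂ ≤ 1 := Nat.le_of_mul_le_mul_left (by simpa using hle) h1
    omega
  rw [hn2, mul_one] at hmul
  exact hqD (hd1 q hq (hmul ▸ hqm))

/-- The factor equals `p + 1` minus a Jacobi symbol, which is at most `1`. -/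
theorem le_localFactor_one {p : ℕ} (hp : p.Prime) (D : ℤ) : (p : ℚ) ≤ localFactor D p 1 := by
  have hp1 : (p : ℚ) - 1 ≠ 0 := sub_ne_zero.mpr (by exact_mod_cast hp.one_lt.ne')
  have hj : (jacobiSym (-D) p : ℚ) ≤ 1 := by
    rcases jacobiSym.trichotomy (-D) p with h | h | h <;> rw [h] <;> norm_num
  rw [localFactor, pow_one, div_self hp1, show (p : ℚ) ^ (1 + 1) - 1 = (p + 1) * (p - 1) by ring,
    mul_div_cancel_right₀ _ hp1]
  linarith

/-- With `n₁ = m_s(L)` and `n₂ = p`, the product reduces to the single factor at `p`. This linear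
growth in `p` is what a plane cannot accommodate. -/
theorem StronglySRegular.le_r {L : TernaryLattice.{u}} (hL : L.StronglySRegular)
    (h : 0 < L.ms) {p : ℕ} (hp : p.Prime) (hpD : ¬ (p : ℤ) ∣ 2 * L.fourDisc) :
    p ≤ r ((L.ms : ℤ) ^ 2 * (p : ℤ) ^ 2) L := by
  have key := hL L.ms p h hp.pos (fun q hq hqm => hL.dvd_of_dvd_ms h hq hqm)
    ((Nat.prime_iff_prime_int.mp hp).coprime_iff_not_dvd.mpr hpD)
  have hfilter : (L.ms * p).primeFactors.filter (fun q : ℕ => ¬ (q : ℤ) ∣ 2 * L.fourDisc) =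
      {p} := by
    ext q
    rw [Finset.mem_filter, Nat.mem_primeFactors, Finset.mem_singleton]
    constructor
    · rintro ⟨⟨hq, hqd, -⟩, hqD⟩
      rcases hq.dvd_mul.mp hqd with hd | hd
      · exact absurd (hL.dvd_of_dvd_ms h hq hd) hqD
      · exact (Nat.prime_dvd_prime_iff_eq hq hp).mp hd
    · rintro rfl
      exact ⟨⟨hp, dvd_mul_left _ _, mul_ne_zero h.ne' hp.ne_zero⟩, hpD⟩
  have hfac : (L.ms * p).factorization p = 1 := by
    rw [Nat.factorization_mul h.ne' hp.ne_zero, Finsupp.add_apply, hp.factorization_self,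
      Nat.factorization_eq_zero_of_not_dvd fun hd => hpD (hL.dvd_of_dvd_ms h hp hd)]
  rw [hfilter, Finset.prod_singleton, hfac] at key
  have hr : (1 : ℚ) ≤ r ((L.ms : ℤ) ^ 2) L := by
    exact_mod_cast Nat.one_le_iff_ne_zero.mpr (r_ms_sq_ne_zero h)
  have hl := le_localFactor_one hp L.fourDisc
  have : (p : ℚ) ≤ r ((L.ms : ℤ) ^ 2 * (p : ℤ) ^ 2) L := by
    rw [key]
    nlinarith [(Nat.cast_nonneg p : (0 : ℚ) ≤ p)]
  exact_mod_cast this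

end TernaryLattice

/-! ### Conclusion -/

theorem mainTheorem1 (m : ℕ) (hm : 0 < m) :
    ∃ S : Set TernaryLattice.{u}, S.Finite ∧
      ∀ L : TernaryLattice.{u}, L.StronglySRegular → L.ms = m →
        ∃ K ∈ S, L.Isometric K := by
  -- The first constant is the bound for coplanar vectors; the second comes from `24 ((pm)²)³ = 24
  -- m⁶ p⁶`, the bound on `|4 dL|`.
  obtain ⟨B, hB⟩ := exists_prime_not_dvd_bounded (8 * (4 * m ^ 2 + 1)) (24 * m ^ 6)
  choose S hSfin hS using TernaryLattice.finite_classes_of_linearIndependent.{u}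
  refine ⟨⋃ p ∈ Finset.range (B + 1), S ((p * m) ^ 2),
    Set.Finite.biUnion (Finset.finite_toSet _) fun p _ => hSfin _, fun L hL hLm => ?_⟩
  obtain ⟨p, hp, hpc, hpD, hpB⟩ := hB L.fourDisc.natAbs (Int.natAbs_ne_zero.mpr L.fourDisc_ne_zero)
  have hpD' : ¬ (p : ℤ) ∣ 2 * L.fourDisc := fun h => hpD (by
    rw [← Int.natAbs_dvd_natAbs, Int.natAbs_mul] at h
    exact h)
  have hle := hL.le_r (hLm ▸ hm) hp hpD'
  rw [hLm] at hle
  have hex : ∃ v : Fin 3 → L.space, LinearIndependent ℚ v ∧ (∀ i, v i ∈ L.lattice) ∧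
      ∀ i, L.form (v i) = (((p * m) ^ 2 : ℕ) : ℚ) := by
    by_contra hcon
    exact absurd (hle.trans (TernaryLattice.r_le_of_coplanar hp hm hcon)) (not_le.mpr hpc)
  obtain ⟨K, hK, hLK⟩ := hS _ L hex
  obtain ⟨v, hv, hvL, hvN⟩ := hex
  have hpB' : p ≤ B := hpB ((TernaryLattice.natAbs_fourDisc_le hv hvL hvN).trans (by
    rw [← pow_mul, mul_pow, mul_assoc, mul_comm (p ^ _)]))
  exact ⟨K, Set.mem_biUnion (Finset.mem_coe.mpr (Finset.mem_range.mpr (by omega))) hK, hLK⟩
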